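/- \textbf{Setting.} Let $L$ be a relational language. A \emph{topological $L$-structure} is a zero-dimensional (Hausdorff, with a basis of clopen sets) compact second countable space together with closed relations interpreting the symbols of $L$. An \emph{epimorphism} $f:\mathcal A\to\mathcal B$ is a continuous surjection such that for every $n$-ary $R\in L$ and all $y_1,\dots,y_n\in B$ we have $(y_1,\dots,y_n)\in R^{\mathcal B}$ if and only if there are $x_1,\dots,x_n\in A$ with $f(x_i)=y_i$ for all $i$ and $(x_1,\dots,x_n)\in R^{\mathcal A}$. An \emph{isomorphism} is a bijective epimorphism. Topological $L$-structures are treated as a category whose morphisms are the epimorphisms, and a class of them as the full subcategory that it spans. A \emph{countable projective Fraïssé family} is a class $\mathbf K$ of finite discrete topological $L$-structures with at most countably many isomorphism types such that for all $\mathcal A,\mathcal B\in\mathbf K$ there is $\mathcal C\in\mathbf K$ with epimorphisms $\mathcal C\to\mathcal A$ and $\mathcal C\to\mathcal B$, and such that for all epimorphisms $f:\mathcal A\to\mathcal C$, $g:\mathcal B\to\mathcal C$ in $\mathbf K$ there are $\mathcal D\in\mathbf K$ and epimorphisms $f':\mathcal D\to\mathcal A$, $g':\mathcal D\to\mathcal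 B$ with $f\circ f'=g\circ g'$. A topological $L$-structure $\mathcal F$ is a \emph{projective Fraïssé limit} of $\mathbf K$ if: (i) for every $\mathcal A\in\mathbf K$ there is an epimorphism $\mathcal F\to\mathcal A$; (ii) for every finite discrete space $X$ and every continuous $f:\mathcal F\to X$ there are $\mathcal A\in\mathbf K$, an epimorphism $e:\mathcal F\to\mathcal A$ and a function $f':A\to X$ with $f=f'\circ e$; (iii) for every $\mathcal A\in\mathbf K$ and all epimorphisms $e_1,e_2:\mathcal F\to\mathcal A$ there is an isomorphism $\psi:\mathcal F\to\mathcal F$ with $e_2=e_1\circ\psi$. For $\mathcal A\in\mathbf K$ the \emph{small dual Ramsey degree} $t^\partial_{\mathbf K}(\mathcal A)$ is the least integer $n\ge 1$ such that for all $k\ge 1$ and all $\mathcal B\in\mathbf K$ there is $\mathcal C\in\mathbf K$ such that for every coloring $\chi:\hom(\mathcal C,\mathcal A)\to\{0,\dots,k-1\}$ there is $w\in\hom(\mathcal C,\mathcal B)$ with $|\chi(\hom(\mathcal B,\mathcal A)\circ w)|\le n$; it is $\infty$ if no such $n$ exists. Suppose that each hom-set of the category $\mathbf K\cup\{\mathcal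 F\}$ carries a topology. The \emph{big dual Ramsey degree} $T^\partial_{\mathbf K\cup\{\mathcal F\}}(\mathcal A,\mathcal F)$ is the least integer $n\ge1$ such that for all $k\ge 2$ and every $\chi:\hom(\mathcal F,\mathcal A)\to\{0,\dots,k-1\}$ all of whose color classes are Borel there is $w\in\hom(\mathcal F,\mathcal F)$ with $|\chi(\hom(\mathcal F,\mathcal A)\circ w)|\le n$; it is $\infty$ if no such $n$ exists. \textbf{Corollary.} Let $\mathbf K$ be a countable projective Fraïssé family of finite topological $L$-structures and let $\mathcal F$ be its projective Fraïssé limit. Let the hom-sets of $\mathbf K\cup\{\mathcal F\}$ carry any Hausdorff topologies (in particular, those of any Hausdorff enrichment over topological spaces, or the topologies of pointwise convergence). Then $$t^\partial_{\mathbf K}(\mathcal A)\le T^\partial_{\mathbf K\cup\{\mathcal F\}}(\mathcal A,\mathcal F)\qquad\text{for every }\mathcal A\in\mathbf K.$$ -/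

import Mathlib

open CategoryTheory

universe u v w

namespace ProjFraisse

/-! ### Ramsey degrees in a category -/

section Degrees

/-- `ArrowSmall A B D k n` is the relation `D ⟶ (B)^A_{k,n}`: for every `k`-coloring of
`hom(A, D)` there is `p : B ⟶ D` such that at most `n` colors occur on `p · hom(A, B)`. -/
def ArrowSmall {C : Type*} [Category C] (A B D : C) (k n : ℕ) : Prop :=
  ∀ χ : (A ⟶ D) → Fin k, ∃ p : B ⟶ D, (χ '' Set.range (fun f : A ⟶ B => f ≫ p)).ncard ≤ n

/-- The small (embedding) Ramsey degree `t_C(A)`: the least positive integer `n` such that for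
all `k ≥ 1` and all `B` there is `D` with `D ⟶ (B)^A_{k,n}`; it is `⊤` if there is no such `n`. -/
noncomputable def smallRamseyDegree {C : Type*} [Category C] (A : C) : ℕ∞ :=
  sInf ((fun n : ℕ => (n : ℕ∞)) ''
    {n : ℕ | 0 < n ∧ ∀ k : ℕ, 1 ≤ k → ∀ B : C, ∃ D : C, ArrowSmall A B D k n})

/-- The small dual Ramsey degree `t^∂_C(A)`: the small Ramsey degree in the opposite category. -/
noncomputable def smallDualRamseyDegree {C : Type*} [Category C] (A : C) : ℕ∞ :=
  smallRamseyDegree (Opposite.op A)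

/-- A choice of a topology on every hom-set of a category. -/
def HomTopology (C : Type*) [Category C] : Type _ :=
  ∀ X Y : C, TopologicalSpace (X ⟶ Y)

/-- Every hom-set is Hausdorff. -/
def HomTopology.IsHausdorff {C : Type*} [Category C] (τ : HomTopology C) : Prop :=
  ∀ X Y : C, @T2Space (X ⟶ Y) (τ X Y)

/-- The same topologies, regarded on the hom-sets of the opposite category. -/
def HomTopology.op {C : Type*} [Category C] (τ : HomTopology C) : HomTopology Cᵒᵖ :=
  fun X Y => TopologicalSpace.induced (fun f : X ⟶ Y => f.unop) (τ Y.unop X.unop)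

/-- `χ` is a Borel coloring: all its color classes are Borel sets. -/
def IsBorelColoring {X : Type*} (t : TopologicalSpace X) {k : ℕ} (χ : X → Fin k) : Prop :=
  ∀ i : Fin k, @MeasurableSet X (@borel X t) (χ ⁻¹' {i})

/-- The Borel version of `ArrowSmall`: only Borel colorings of `hom(A, D)` are considered. -/
def ArrowBorel {C : Type*} [Category C] (τ : HomTopology C) (A B D : C) (k n : ℕ) : Prop :=
  ∀ χ : (A ⟶ D) → Fin k, IsBorelColoring (τ A D) χ →
    ∃ p : B ⟶ D, (χ '' Set.range (fun f : A ⟶ B => f ≫ p)).ncard ≤ n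

/-- The big (embedding) Ramsey degree `T_C(A, S)`: the least positive integer `n` such that for
all `k ≥ 2`, every Borel `k`-coloring of `hom(A, S)` admits `p : S ⟶ S` with at most `n` colors on
`p · hom(A, S)`; it is `⊤` if there is no such `n`. -/
noncomputable def bigRamseyDegree {C : Type*} [Category C] (τ : HomTopology C) (A S : C) : ℕ∞ :=
  sInf ((fun n : ℕ => (n : ℕ∞)) ''
    {n : ℕ | 0 < n ∧ ∀ k : ℕ, 2 ≤ k → ArrowBorel τ A S S k n})

/-- The big dual Ramsey degree `T^∂_C(A, S)`: the big Ramsey degree in the opposite category. -/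
noncomputable def bigDualRamseyDegree {C : Type*} [Category C] (τ : HomTopology C) (A S : C) :
    ℕ∞ :=
  bigRamseyDegree τ.op (Opposite.op A) (Opposite.op S)

end Degrees

/-! ### Topological structures and epimorphisms -/

/-- A topological `L`-structure: a zero-dimensional (Hausdorff with a basis of clopen sets)
compact second countable space with closed relations interpreting the symbols of the
relational language `L`. -/
structure TopStructure (L : FirstOrder.Language.{v, w}) [L.IsRelational] where
  carrier : Type u
  [topology : TopologicalSpace carrier]
  [str : L.Structure carrier]
  t2 : T2Space carrier
  clopen_basis : TopologicalSpace.IsTopologicalBasis {s : Set carrier | IsClopen s}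
  compact : CompactSpace carrier
  secondCountable : SecondCountableTopology carrier
  isClosed_rel : ∀ (n : ℕ) (R : L.Relations n),
    IsClosed {x : Fin n → carrier | FirstOrder.Language.Structure.RelMap R x}

attribute [instance] TopStructure.topology TopStructure.str

variable {L : FirstOrder.Language.{v, w}} [L.IsRelational]

/-- An epimorphism of topological `L`-structures: a continuous surjection such that a tuple of the
target is in a relation iff it is the image of a tuple of the source that is in this relation. -/
@[ext]
structure Epimorphism (A B : TopStructure.{u} L) where
  toFun : A.carrier → B.carrier
  continuous : Continuous toFun
  surjective : Function.Surjective toFun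
  rel_iff : ∀ (n : ℕ) (R : L.Relations n) (y : Fin n → B.carrier),
    FirstOrder.Language.Structure.RelMap R y ↔
      ∃ x : Fin n → A.carrier, (∀ i, toFun (x i) = y i) ∧
        FirstOrder.Language.Structure.RelMap R x

/-- The category of topological `L`-structures and epimorphisms. -/
instance : Category (TopStructure.{u} L) where
  Hom A B := Epimorphism A B
  id A :=
    { toFun := id
      continuous := continuous_id
      surjective := Function.surjective_id
      rel_iff := fun n R y => by
        constructor
        · intro h
          exact ⟨y, fun _ => rfl, h⟩
        · rintro ⟨x, hx, h⟩
          have hxy : x = y := funext hx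
          exact hxy ▸ h }
  comp f g :=
    { toFun := g.toFun ∘ f.toFun
      continuous := g.continuous.comp f.continuous
      surjective := g.surjective.comp f.surjective
      rel_iff := fun n R z => by
        rw [g.rel_iff n R z]
        constructor
        · rintro ⟨y, hy, h⟩
          obtain ⟨x, hx, h'⟩ := (f.rel_iff n R y).1 h
          exact ⟨x, fun i => by rw [Function.comp_apply, hx i, hy i], h'⟩
        · rintro ⟨x, hx, h⟩
          exact ⟨fun i => f.toFun (x i), hx, (f.rel_iff n R _).2 ⟨x, fun _ => rfl, h⟩⟩ }

/-- An isomorphism of topological `L`-structures is a bijective epimorphism. -/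
def IsIsomorphism {A B : TopStructure.{u} L} (f : A ⟶ B) : Prop :=
  Function.Bijective f.toFun

/-- A countable projective Fraïssé family of finite (discrete) topological `L`-structures:
up to isomorphism there are only countably many members, and the projective joint embedding
property and projective amalgamation hold. -/
structure IsProjectiveFraisseFamily (K : ObjectProperty (TopStructure.{u} L)) : Prop where
  finite : ∀ A : TopStructure.{u} L, K A → Finite A.carrier
  discrete : ∀ A : TopStructure.{u} L, K A → DiscreteTopology A.carrier
  countable : ∃ S : Set (TopStructure.{u} L), S.Countable ∧ (∀ B ∈ S, K B) ∧
    ∀ A : TopStructure.{u} L, K A → ∃ B ∈ S, ∃ f : A ⟶ B, IsIsomorphism f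
  jointEmbedding : ∀ A B : TopStructure.{u} L, K A → K B →
    ∃ C : TopStructure.{u} L, K C ∧ Nonempty (C ⟶ A) ∧ Nonempty (C ⟶ B)
  amalgamation : ∀ A B C : TopStructure.{u} L, K A → K B → K C → ∀ (f : A ⟶ C) (g : B ⟶ C),
    ∃ D : TopStructure.{u} L, K D ∧ ∃ (f' : D ⟶ A) (g' : D ⟶ B), f' ≫ f = g' ≫ g

/-- `F` is a projective Fraïssé limit of `K`: projective universality, the projective hereditary
property and projective ultrahomogeneity. -/
structure IsProjectiveFraisseLimit (K : ObjectProperty (TopStructure.{u} L))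
    (F : TopStructure.{u} L) : Prop where
  universal : ∀ A : TopStructure.{u} L, K A → Nonempty (F ⟶ A)
  hereditary : ∀ (X : Type u) [Finite X] [TopologicalSpace X] [DiscreteTopology X]
    (f : F.carrier → X), Continuous f →
      ∃ A : TopStructure.{u} L, K A ∧ ∃ (e : F ⟶ A) (f' : A.carrier → X), f = f' ∘ e.toFun
  ultrahomogeneous : ∀ A : TopStructure.{u} L, K A → ∀ e₁ e₂ : F ⟶ A,
    ∃ ψ : F ⟶ F, IsIsomorphism ψ ∧ e₂ = ψ ≫ e₁

/-- The class `K ∪ {F}`, spanning a full subcategory. -/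
def adjoin (K : ObjectProperty (TopStructure.{u} L)) (F : TopStructure.{u} L) :
    ObjectProperty (TopStructure.{u} L) :=
  fun X => K X ∨ X = F

end ProjFraisse

namespace ProjFraisse

variable {L : FirstOrder.Language.{v, w}} [L.IsRelational]

/-! A continuous map from `F` to a finite discrete `A` is determined by its clopen fibres, and `F`
has only countably many clopen sets. So hom(F, A) is countable, every coloring of it is Borel in any
Hausdorff topology, and the bound `n` for the big degree applies to all colorings. The rest is
compactness (`exists_arrow_of_limit`). If some `B` defeats every `C` in `K`, choose a bad coloring
of each hom(C, A). The finite quotients of `F` are directed, and an ultrafilter along them glues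
these colorings into one coloring of hom(F, A). A good `w : F ⟶ F` for it, followed by `F ⟶ B`,
factors through a quotient whose own coloring agrees on the finitely many relevant maps, a
contradiction. -/

theorem TopStructure.countable_clopens (F : TopStructure.{u} L) :
    Countable (TopologicalSpace.Clopens F.carrier) := by
  have := F.compact
  have := F.secondCountable
  have := F.t2
  have : TotallySeparatedSpace F.carrier :=
    totallySeparatedSpace_of_t0_of_basis_clopen F.clopen_basis
  exact TopologicalSpace.Clopens.countable_iff_secondCountable.2 inferInstance

theorem countable_hom (F A : TopStructure.{u} L) [Finite A.carrier] [DiscreteTopology A.carrier] :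
    Countable (F ⟶ A) := by
  have := F.countable_clopens
  let preimages (f : F ⟶ A) (a : A.carrier) : TopologicalSpace.Clopens F.carrier :=
    ⟨f.toFun ⁻¹' {a}, (isClopen_discrete {a}).preimage f.continuous⟩
  refine Function.Injective.countable (f := preimages) fun f g h => Epimorphism.ext ?_
  funext x
  have hx : x ∈ preimages g (f.toFun x) := by
    rw [← h]
    exact (rfl : f.toFun x = f.toFun x)
  exact Eq.symm hx

theorem finite_hom (B A : TopStructure.{u} L) [Finite B.carrier] [Finite A.carrier] :
    Finite (B ⟶ A) :=
  Finite.of_injective (fun f : B ⟶ A => f.toFun) fun _ _ h => Epimorphism.ext h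

theorem hom_ext_of_comp {F C A : TopStructure.{u} L} (e : F ⟶ C) {f g : C ⟶ A}
    (h : e ≫ f = e ≫ g) : f = g := by
  refine Epimorphism.ext (funext fun y => ?_)
  obtain ⟨x, rfl⟩ := e.surjective y
  exact congrFun (congrArg Epimorphism.toFun h) x

/-- A map through which an epimorphism factors on a discrete quotient is an epimorphism. -/
theorem exists_hom_of_factors {F C A : TopStructure.{u} L} [DiscreteTopology C.carrier]
    (e : F ⟶ C) (f : F ⟶ A) (g : C.carrier → A.carrier) (h : f.toFun = g ∘ e.toFun) :
    ∃ g' : C ⟶ A, f = e ≫ g' := by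
  refine ⟨⟨g, continuous_of_discreteTopology, ?_, fun n R y => ?_⟩, Epimorphism.ext h⟩
  · exact Function.Surjective.of_comp (h ▸ f.surjective)
  · rw [f.rel_iff n R y]
    constructor
    · rintro ⟨x, hx, hR⟩
      exact ⟨fun i => e.toFun (x i), fun i => (congrFun h (x i)).symm.trans (hx i),
        (e.rel_iff n R _).2 ⟨x, fun _ => rfl, hR⟩⟩
    · rintro ⟨z, hz, hR⟩
      obtain ⟨x, hx, hR'⟩ := (e.rel_iff n R z).1 hR
      exact ⟨x, fun i => (congrFun h (x i)).trans ((congrArg g (hx i)).trans (hz i)), hR'⟩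

/-- The epimorphisms from `F` onto members of `K`. -/
structure FiniteQuotient (K : ObjectProperty (TopStructure.{u} L)) (F : TopStructure.{u} L) where
  obj : TopStructure.{u} L
  mem : K obj
  proj : F ⟶ obj

/-- Finite quotients are ordered by factorization: finer quotients are larger. -/
instance (K : ObjectProperty (TopStructure.{u} L)) (F : TopStructure.{u} L) :
    Preorder (FiniteQuotient K F) where
  le p q := ∃ g : q.obj ⟶ p.obj, p.proj = q.proj ≫ g
  le_refl p := ⟨𝟙 _, (Category.comp_id _).symm⟩
  le_trans := by
    rintro p q r ⟨g, hg⟩ ⟨h, hh⟩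
    exact ⟨h ≫ g, by rw [hg, hh, Category.assoc]⟩

/-- The pair of two projections is a continuous map to a finite discrete space, so the projective
hereditary property factors it through a common refinement. -/
theorem isDirected_finiteQuotient {K : ObjectProperty (TopStructure.{u} L)}
    {F : TopStructure.{u} L} (hK : IsProjectiveFraisseFamily K)
    (hF : IsProjectiveFraisseLimit K F) : IsDirected (FiniteQuotient K F) (· ≤ ·) := by
  refine ⟨fun p q => ?_⟩
  have := hK.finite _ p.mem
  have := hK.finite _ q.mem
  have := hK.discrete _ p.mem
  have := hK.discrete _ q.mem
  obtain ⟨C, hC, e, g, hg⟩ := hF.hereditary (p.obj.carrier × q.obj.carrier)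
    (fun x => (p.proj.toFun x, q.proj.toFun x)) (p.proj.continuous.prodMk q.proj.continuous)
  have := hK.discrete _ hC
  exact ⟨⟨C, hC, e⟩,
    exists_hom_of_factors e p.proj (Prod.fst ∘ g) (congrArg (Prod.fst ∘ ·) hg),
    exists_hom_of_factors e q.proj (Prod.snd ∘ g) (congrArg (Prod.snd ∘ ·) hg)⟩

theorem exists_eventually_eq_of_finite {ι α : Type*} [Finite α] (U : Ultrafilter ι) (f : ι → α) :
    ∃ a, ∀ᶠ i in U, f i = a := by
  obtain ⟨a, ha⟩ := Ultrafilter.eq_pure_of_finite (U.map f)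
  refine ⟨a, ?_⟩
  have h : ({a} : Set α) ∈ U.map f := by rw [ha]; exact Set.mem_singleton a
  exact h

/-- If every coloring of `hom(F, A)` has few colors on some `hom(F, A) ∘ w`, then by compactness
the same holds for some member of `K` and `hom(B, A)`. -/
theorem exists_arrow_of_limit {K : ObjectProperty (TopStructure.{u} L)} {F : TopStructure.{u} L}
    (hK : IsProjectiveFraisseFamily K) (hF : IsProjectiveFraisseLimit K F)
    {A B : TopStructure.{u} L} (hA : K A) (hB : K B) {k n : ℕ}
    (hbig : ∀ χ : (F ⟶ A) → Fin k,
      ∃ w : F ⟶ F, (χ '' Set.range (fun f : F ⟶ A => w ≫ f)).ncard ≤ n) :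
    ∃ C : TopStructure.{u} L, K C ∧ ∀ χ : (C ⟶ A) → Fin k,
      ∃ w : C ⟶ B, (χ '' Set.range (fun f : B ⟶ A => w ≫ f)).ncard ≤ n := by
  classical
  by_contra! hbad
  choose χ hχ using hbad
  have := hK.finite _ hA
  have := hK.finite _ hB
  have := finite_hom B A
  have := isDirected_finiteQuotient hK hF
  obtain ⟨eB⟩ := hF.universal B hB
  have : Nonempty (FiniteQuotient K F) := ⟨⟨B, hB, eB⟩⟩
  -- By directedness `atTop` is a proper filter, so some ultrafilter contains every upper cone.
  let U : Ultrafilter (FiniteQuotient K F) := Ultrafilter.of Filter.atTop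
  have hU : (U : Filter (FiniteQuotient K F)) ≤ Filter.atTop := Ultrafilter.of_le _
  have hlim (f : F ⟶ A) : ∃ c : Fin k, ∀ᶠ p in (U : Filter (FiniteQuotient K F)),
      ∀ g : p.obj ⟶ A, f = p.proj ≫ g → χ p.obj p.mem g = c := by
    -- `none` marks the quotients through which `f` does not factor. The chosen factor is harmless:
    -- factors through the surjection `p.proj` are unique.
    let color (p : FiniteQuotient K F) : Option (Fin k) :=
      if h : ∃ g : p.obj ⟶ A, f = p.proj ≫ g then some (χ p.obj p.mem h.choose) else none
    have hcolor (p : FiniteQuotient K F) (g : p.obj ⟶ A) (hg : f = p.proj ≫ g) :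
        color p = some (χ p.obj p.mem g) := by
      have h : ∃ g : p.obj ⟶ A, f = p.proj ≫ g := ⟨g, hg⟩
      have : h.choose = g := hom_ext_of_comp p.proj (h.choose_spec.symm.trans hg)
      simp only [color, dif_pos h, this]
    obtain ⟨c, hc⟩ := exists_eventually_eq_of_finite U color
    -- `f` is itself a finite quotient, so it factors through all finer ones; hence the limit color
    -- is not `none`.
    obtain ⟨p, hp, g, hg⟩ :=
      (hc.and (hU (Filter.eventually_ge_atTop ⟨A, hA, f⟩))).exists
    refine ⟨χ p.obj p.mem g, hc.mono fun q hq g' hg' => Option.some_injective _ ?_⟩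
    rw [← hcolor q g' hg', ← hcolor p g hg, hq, hp]
  choose χF hχF using hlim
  obtain ⟨w, hw⟩ := hbig χF
  have hev : ∀ᶠ p in (U : Filter (FiniteQuotient K F)), ∀ f : B ⟶ A, ∀ g : p.obj ⟶ A,
      -- Finiteness of hom(B, A) gives agreement for all `f` at once.
      w ≫ eB ≫ f = p.proj ≫ g → χ p.obj p.mem g = χF (w ≫ eB ≫ f) :=
    Filter.eventually_all.2 fun f => hχF _
  -- Above the quotient `w ≫ eB`, this map factors as `p.proj ≫ g`; the map `g : p.obj ⟶ B` refutes
  -- the badness of the coloring at `p.obj`.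
  obtain ⟨p, hp, g, hg⟩ := (hev.and (hU (Filter.eventually_ge_atTop ⟨B, hB, w ≫ eB⟩))).exists
  refine (hχ p.obj p.mem g).not_ge ((Set.ncard_le_ncard ?_ (Set.toFinite _)).trans hw)
  rintro _ ⟨_, ⟨f, rfl⟩, rfl⟩
  refine ⟨_, ⟨eB ≫ f, rfl⟩, (hp f _ ?_).symm⟩
  rw [← Category.assoc, ← Category.assoc]
  exact congrArg (· ≫ f) hg

theorem HomTopology.IsHausdorff.op {C : Type*} [Category C] {τ : HomTopology C}
    (hτ : τ.IsHausdorff) : τ.op.IsHausdorff := fun X Y =>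
  letI := τ Y.unop X.unop
  letI := τ.op X Y
  haveI := hτ Y.unop X.unop
  T2Space.of_injective_continuous (f := fun f : X ⟶ Y => f.unop) Quiver.Hom.unop_inj
    continuous_induced_dom

theorem isBorelColoring_of_countable {X : Type*} [Countable X] (t : TopologicalSpace X)
    [T2Space X] {k : ℕ} (χ : X → Fin k) : IsBorelColoring t χ := by
  intro i
  let := borel X
  have : BorelSpace X := ⟨rfl⟩
  exact (Set.to_countable _).measurableSet

end ProjFraisse

open ProjFraisse in
theorem mainTheorem10 (L : FirstOrder.Language.{v, w}) [L.IsRelational]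
    (K : CategoryTheory.ObjectProperty (ProjFraisse.TopStructure.{u} L))
    (hK : ProjFraisse.IsProjectiveFraisseFamily K)
    (F : ProjFraisse.TopStructure.{u} L)
    (hF : ProjFraisse.IsProjectiveFraisseLimit K F)
    (τ : ProjFraisse.HomTopology (ProjFraisse.adjoin K F).FullSubcategory)
    (hτ : τ.IsHausdorff)
    (A : ProjFraisse.TopStructure.{u} L) (hA : K A) :
    ProjFraisse.smallDualRamseyDegree (C := K.FullSubcategory) ⟨A, hA⟩ ≤
      ProjFraisse.bigDualRamseyDegree (C := (ProjFraisse.adjoin K F).FullSubcategory) τ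
        ⟨A, Or.inl hA⟩ ⟨F, Or.inr rfl⟩ := by
  refine le_sInf ?_
  rintro _ ⟨n, ⟨hn, hbig⟩, rfl⟩
  refine sInf_le ⟨n, ⟨hn, fun k hk B => ?_⟩, rfl⟩
  -- The big degree only speaks of `k ≥ 2`; for `k = 1` a single color occurs and `n` is positive.
  obtain rfl | hk2 := hk.eq_or_lt
  · refine ⟨B, fun χ => ⟨𝟙 B, le_trans ?_ hn⟩⟩
    exact Set.ncard_le_one_of_subsingleton _
  have := hK.finite _ hA
  have := hK.discrete _ hA
  have hcount := countable_hom F A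
  obtain ⟨C, hC, h⟩ := exists_arrow_of_limit (k := k) (n := n) hK hF hA B.unop.property
    fun χ => by
      have : Countable ((Opposite.op ⟨A, Or.inl hA⟩ : (adjoin K F).FullSubcategoryᵒᵖ) ⟶
          Opposite.op ⟨F, Or.inr rfl⟩) :=
        Function.Injective.countable (f := fun f => f.unop.hom) fun f g hfg =>
          Quiver.Hom.unop_inj (ObjectProperty.hom_ext _ hfg)
      have := hτ.op (Opposite.op ⟨A, Or.inl hA⟩) (Opposite.op ⟨F, Or.inr rfl⟩)
      obtain ⟨p, hp⟩ := hbig k hk2 (fun f => χ f.unop.hom) (isBorelColoring_of_countable _ _)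
      refine ⟨p.unop.hom, (Set.ncard_le_ncard ?_ (Set.toFinite _)).trans hp⟩
      rintro _ ⟨_, ⟨f, rfl⟩, rfl⟩
      exact ⟨_, ⟨Quiver.Hom.op (ObjectProperty.homMk f), rfl⟩, rfl⟩
  refine ⟨Opposite.op ⟨C, hC⟩, fun χ => ?_⟩
  obtain ⟨w, hw⟩ := h fun f => χ (Quiver.Hom.op (ObjectProperty.homMk f))
  refine ⟨Quiver.Hom.op (ObjectProperty.homMk w),
    (Set.ncard_le_ncard ?_ (Set.toFinite _)).trans hw⟩
  rintro _ ⟨_, ⟨f, rfl⟩, rfl⟩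
  exact ⟨_, ⟨f.unop.hom, rfl⟩, rfl⟩
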